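/- Let $G$ be a Lie group modelled on a Hausdorff locally convex real topological vector space, where smoothness is understood in the sense of Bastiani calculus, and let $\mathfrak g = T_1G$ be its Lie algebra, with the bracket of left-invariant vector fields. Suppose that $G$ is Milnor regular: every smooth curve $\xi\colon[0,1]\to\mathfrak g$ admits a smooth curve $\gamma_\xi\colon[0,1]\to G$ with $\gamma_\xi(0)=1$ and $\gamma_\xi'(t)=\gamma_\xi(t).\xi(t)$ for all $t$ (where $g.X$ denotes the image of $X\in\mathfrak g$ under the tangent map at $1$ of left translation by $g$), and the map $C^\infty([0,1],\mathfrak g)\to G$, $\xi\mapsto\gamma_\xi(1)$, is smooth, where $C^\infty([0,1],\mathfrak g)$ carries the topology of uniform convergence of each derivative. Suppose further that 1. $H^2_c(\mathfrak g,\mathbb R)=0$, that is, every continuous alternating bilinear form $\eta$ on $\mathfrak g$ with $\eta([X,Y],Z)+\eta([Y,Z],X)+\eta([Z,X],Y)=0$ for all $X,Y,Z\in\mathfrak g$ is of the form $\eta(X,Y)=p([X,Y])$ for some continuous linear functional $p\colon\mathfrak g\to\mathbb R$; and 2. $[\mathfrak g,[\mathfrak g,\mathfrak g]]$ is dense in $[\mathfrak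 g,\mathfrak g]$, where $[\mathfrak g,\mathfrak g]$ is the linear span of all brackets $[X,Y]$ with $X,Y\in\mathfrak g$, and $[\mathfrak g,[\mathfrak g,\mathfrak g]]$ is the linear span of all $[X,Y]$ with $X\in\mathfrak g$ and $Y\in[\mathfrak g,\mathfrak g]$. Then the space of bi-invariant differential $2$-forms on $G$ vanishes: if $\omega$ is a smooth differential $2$-form on $G$ with $L_g^*\omega=\omega=R_g^*\omega$ for all $g\in G$ (where $L_g$ and $R_g$ denote left and right translation by $g$), then $\omega=0$. -/

import Mathlib

open Set Filter Topology
open scoped unitInterval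

noncomputable section

namespace LCLie

universe u v w z

/-! ### Calculus on locally convex spaces (Bastiani calculus) -/

section Calculus

variable {E : Type u} [AddCommGroup E] [Module ℝ E] [TopologicalSpace E]
  {F : Type v} [AddCommGroup F] [Module ℝ F] [TopologicalSpace F]

/-- `d` is the directional derivative of `f` at `x` in the direction `y`, i.e. the limit of
`t⁻¹ (f (x + t y) - f x)` as `t → 0`, `t ≠ 0`. -/
def HasDirDeriv (f : E → F) (d : F) (x y : E) : Prop :=
  Tendsto (fun t : ℝ => t⁻¹ • (f (x + t • y) - f x)) (𝓝[≠] 0) (𝓝 d)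

/-- The directional derivative `df(x; y)` (an unspecified value if it does not exist). -/
def dirDeriv (f : E → F) (x y : E) : F :=
  limUnder (𝓝[≠] (0 : ℝ)) fun t : ℝ => t⁻¹ • (f (x + t • y) - f x)

/-- `f` is smooth (`C^∞` in the sense of Bastiani) on the open set `U`: all the iterated directional
derivatives `d^k f (x; y₁, …, y_k) = (D_{y_k} ⋯ D_{y₁} f)(x)` exist for `x ∈ U`, and
`d^k f : U × E^k → F` is continuous for every `k ≥ 0`. -/
def SmoothOn (f : E → F) (U : Set E) : Prop :=
  ∃ D : (k : ℕ) → E → (Fin k → E) → F,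
    (∀ x ∈ U, ∀ y : Fin 0 → E, D 0 x y = f x) ∧
    (∀ (k : ℕ), ∀ x ∈ U, ∀ (y : Fin k → E) (z : E),
      HasDirDeriv (fun x' => D k x' y) (D (k + 1) x (Fin.snoc y z : Fin (k + 1) → E)) x z) ∧
    (∀ k : ℕ, ContinuousOn (fun p : E × (Fin k → E) => D k p.1 p.2) (U ×ˢ univ))

/-- `d` is the derivative at `t` of the curve `c` defined on `[0,1]` (one-sided if `t` is an
end-point). -/
def HasPathDeriv (c : I → F) (d : F) (t : I) : Prop :=
  Tendsto (fun s : I => ((s : ℝ) - (t : ℝ))⁻¹ • (c s - c t)) (𝓝[≠] t) (𝓝 d)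

end Calculus

section SmoothPath

variable (F : Type v) [AddCommGroup F] [Module ℝ F] [TopologicalSpace F]
  [IsTopologicalAddGroup F] [ContinuousSMul ℝ F]

/-- The space `C^∞([0,1], F)`. A smooth curve `c` is given together with the sequence
`(c, c', c'', …)` of its derivatives, each of which is continuous; this sequence is determined by
its `0`-th term when `F` is Hausdorff. The topology is the one induced from `∏_k C([0,1], F)`, that
is, the compact-open `C^∞`-topology: uniform convergence of each derivative. -/
def SmoothPath : Submodule ℝ (ℕ → C(I, F)) where
  carrier := {c | ∀ (n : ℕ) (t : I), HasPathDeriv (c n) (c (n + 1) t) t}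
  add_mem' := by
    intro a b ha hb n t
    refine ((ha n t).add (hb n t)).congr fun s => ?_
    simp only [Pi.add_apply, ContinuousMap.add_apply]
    rw [← smul_add]
    congr 1
    abel
  zero_mem' := by
    intro n t
    simpa [HasPathDeriv] using tendsto_const_nhds
  smul_mem' := by
    intro r a ha n t
    refine ((ha n t).const_smul r).congr fun s => ?_
    simp only [Pi.smul_apply, ContinuousMap.smul_apply]
    rw [← smul_sub, smul_comm]

end SmoothPath

/-! ### Locally convex manifolds -/

section Manifold

/-- The tangent space `T_p M` of a manifold modelled on `E`, identified with `E` through the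
preferred chart `chartAt E p` at `p`. -/
def TangentAt (E : Type u) {M : Type w} (_p : M) : Type u := E

section

variable {E : Type u} {M : Type w} (p : M)

instance [h : AddCommGroup E] : AddCommGroup (TangentAt E p) := h

instance [AddCommGroup E] [h : Module ℝ E] : Module ℝ (TangentAt E p) := h

instance [h : TopologicalSpace E] : TopologicalSpace (TangentAt E p) := h

instance [AddCommGroup E] [TopologicalSpace E] [h : IsTopologicalAddGroup E] :
    IsTopologicalAddGroup (TangentAt E p) := h

instance [AddCommGroup E] [Module ℝ E] [TopologicalSpace E] [h : ContinuousSMul ℝ E] :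
    ContinuousSMul ℝ (TangentAt E p) := h

instance [AddCommGroup E] [Module ℝ E] [TopologicalSpace E] [h : LocallyConvexSpace ℝ E] :
    LocallyConvexSpace ℝ (TangentAt E p) := h

instance [TopologicalSpace E] [h : T2Space E] : T2Space (TangentAt E p) := h

end

variable (E : Type u) [AddCommGroup E] [Module ℝ E] [TopologicalSpace E]
  (F : Type v) [AddCommGroup F] [Module ℝ F] [TopologicalSpace F]
  {M : Type w} [TopologicalSpace M] [ChartedSpace E M]
  {N : Type z} [TopologicalSpace N] [ChartedSpace F N]

variable (M) in
/-- The atlas of `M` is smooth: all the transition maps are smooth. -/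
def IsSmoothAtlas : Prop :=
  ∀ e ∈ atlas E M, ∀ e' ∈ atlas E M,
    SmoothOn (fun x : E => e' (e.symm x)) {x | x ∈ e.target ∧ e.symm x ∈ e'.source}

/-- Smooth maps `M → N` of manifolds: continuous, and smooth in charts. -/
def SmoothMap (f : M → N) : Prop :=
  Continuous f ∧ ∀ e ∈ atlas E M, ∀ e' ∈ atlas F N,
    SmoothOn (fun x : E => e' (f (e.symm x))) {x | x ∈ e.target ∧ f (e.symm x) ∈ e'.source}

/-- The tangent map `T_p f : T_p M → T_{f p} N`. -/
def tangentMap (f : M → N) (p : M) (y : TangentAt E p) : TangentAt F (f p) :=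
  dirDeriv (fun x : E => chartAt F (f p) (f ((chartAt E p).symm x))) (chartAt E p p) y

/-- Smooth curves `[0,1] → M`: continuous, and possessing derivatives of all orders in each chart. -/
def IsSmoothPath (γ : I → M) : Prop :=
  Continuous γ ∧ ∀ e ∈ atlas E M, ∃ c : ℕ → I → E,
    (∀ t, γ t ∈ e.source → c 0 t = e (γ t)) ∧
    ∀ n t, γ t ∈ e.source → HasPathDeriv (c n) (c (n + 1) t) t

/-- The curve `γ : [0,1] → M` has velocity `y ∈ T_{γ t} M` at time `t`. -/
def HasVelocity (γ : I → M) (t : I) (y : TangentAt E (γ t)) : Prop :=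
  HasPathDeriv (F := E) (fun s => chartAt E (γ t) (γ s)) y t

/-- The expression in the chart `e` of a vector field `X` on `M`: at `x = e p` it is `T_p e (X p)`. -/
def localRep (X : (p : M) → TangentAt E p) (e : OpenPartialHomeomorph M E) (x : E) : E :=
  tangentMap E E (e : M → E) (e.symm x) (X (e.symm x))

/-- The Lie bracket of two vector fields at `p`: in the preferred chart at `p`,
`[X, Y](x) = dY(x; X(x)) - dX(x; Y(x))`. -/
def vfBracket (X Y : (p : M) → TangentAt E p) (p : M) : TangentAt E p :=
  let e := chartAt E p
  let x := e p
  dirDeriv (localRep E Y e) x (localRep E X e x) - dirDeriv (localRep E X e) x (localRep E Y e x)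

variable (M) in
/-- Families of continuous alternating `k`-linear forms on the tangent spaces of `M`. -/
abbrev FormField (k : ℕ) : Type (max u w) := (p : M) → (TangentAt E p) [⋀^Fin k]→L[ℝ] ℝ

/-- `ω` is a (smooth) differential `k`-form: in each chart `e`, its expression
`(x, y₁, …, y_k) ↦ ω_{e⁻¹ x} (T_x e⁻¹ y₁, …, T_x e⁻¹ y_k)` is smooth on `e.target × E^k`. -/
def IsDifferentialForm {k : ℕ} (ω : FormField E M k) : Prop :=
  ∀ e ∈ atlas E M, SmoothOn
    (fun q : E × (Fin k → E) =>
      ω (e.symm q.1) (fun i => tangentMap E E (e.symm : E → M) q.1 (q.2 i)))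
    (e.target ×ˢ univ)

end Manifold

/-! ### Lie groups -/

section LieGroup

variable (E : Type u) [AddCommGroup E] [Module ℝ E] [TopologicalSpace E]
  (G : Type w) [Group G] [TopologicalSpace G] [ChartedSpace E G]

/-- `G` is a Lie group modelled on `E`: a smooth manifold such that the multiplication
`G × G → G` (expressed in product charts of `G × G`) and the inversion are smooth. -/
structure IsLieGroup : Prop where
  smooth_atlas : IsSmoothAtlas E G
  continuous_mul : Continuous fun p : G × G => p.1 * p.2
  smooth_mul : ∀ e₁ ∈ atlas E G, ∀ e₂ ∈ atlas E G, ∀ e₃ ∈ atlas E G,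
    SmoothOn (fun p : E × E => e₃ (e₁.symm p.1 * e₂.symm p.2))
      {p | p.1 ∈ e₁.target ∧ p.2 ∈ e₂.target ∧ e₁.symm p.1 * e₂.symm p.2 ∈ e₃.source}
  smooth_inv : SmoothMap E E fun g : G => g⁻¹

/-- The Lie algebra `𝔤 = T_1 G`. -/
abbrev LieAlg : Type u := TangentAt E (1 : G)

variable {G} in
/-- The left-invariant vector field `g ↦ g.y = T_1 L_g (y)` defined by `y ∈ 𝔤`. -/
def leftInvariant (y : LieAlg E G) (g : G) : TangentAt E g :=
  tangentMap E E (fun h : G => g * h) 1 y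

/-- The bracket of `𝔤`: the value at `1` of the bracket of left-invariant vector fields. -/
instance : Bracket (LieAlg E G) (LieAlg E G) where
  bracket y z := vfBracket E (leftInvariant E y) (leftInvariant E z) 1

/-- `G` is Milnor regular: each `ξ ∈ C^∞([0,1], 𝔤)` has a smooth (left) evolution
`γ = Evol ξ : [0,1] → G`, that is, `γ 0 = 1` and `γ'(t) = γ(t).ξ(t)` for all `t`, and the map
`evol : C^∞([0,1], 𝔤) → G`, `ξ ↦ Evol ξ 1`, is smooth. -/
def IsMilnorRegular [IsTopologicalAddGroup E] [ContinuousSMul ℝ E] : Prop :=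
  ∃ Evol : SmoothPath (LieAlg E G) → I → G,
    (∀ ξ, IsSmoothPath E (Evol ξ) ∧ Evol ξ 0 = 1 ∧
      ∀ t, HasVelocity E (Evol ξ) t (leftInvariant E (ξ.1 0 t) (Evol ξ t))) ∧
    SmoothMap (SmoothPath (LieAlg E G)) E (fun ξ => Evol ξ 1)

variable {G} in
/-- `L_g^* ω = ω = R_g^* ω` for all `g ∈ G`. -/
def IsBiinvariant {k : ℕ} (ω : FormField E G k) : Prop :=
  ∀ (g h : G) (y : Fin k → TangentAt E h),
    ω (g * h) (fun i => tangentMap E E (fun x : G => g * x) h (y i)) = ω h y ∧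
    ω (h * g) (fun i => tangentMap E E (fun x : G => x * g) h (y i)) = ω h y

/-- The set `Ω^k_I(G)` of bi-invariant differential `k`-forms on `G`. -/
def biinvariantForms (k : ℕ) : Set (FormField E G k) :=
  {ω | IsDifferentialForm E ω ∧ IsBiinvariant E ω}

end LieGroup

/-! ### Topological Lie algebras -/

section LieAlgebra

variable (L : Type u) [AddCommGroup L] [Module ℝ L] [TopologicalSpace L] [Bracket L L]

/-- Continuous 2-cocycles of the Chevalley–Eilenberg complex with trivial coefficients `ℝ`. -/
def cocycles₂ : Submodule ℝ (L [⋀^Fin 2]→L[ℝ] ℝ) where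
  carrier := {η | ∀ x y z : L, η ![⁅x, y⁆, z] + η ![⁅y, z⁆, x] + η ![⁅z, x⁆, y] = 0}
  add_mem' := by
    intro a b ha hb x y z
    have h₁ := ha x y z
    have h₂ := hb x y z
    simp only [ContinuousAlternatingMap.add_apply]
    linarith
  zero_mem' := by
    intro x y z
    simp
  smul_mem' := by
    intro r a ha x y z
    have h := ha x y z
    simp only [ContinuousAlternatingMap.smul_apply, smul_eq_mul]
    rw [← mul_add, ← mul_add, h, mul_zero]

/-- Continuous 2-coboundaries: `η = δp`, i.e. `η(x, y) = -p([x, y])`, for a continuous linear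
functional `p` (a continuous 1-cochain). -/
def coboundaries₂ : Submodule ℝ (L [⋀^Fin 2]→L[ℝ] ℝ) where
  carrier := {η | ∃ p : L →L[ℝ] ℝ, ∀ x y : L, η ![x, y] = -p ⁅x, y⁆}
  add_mem' := by
    rintro a b ⟨p, hp⟩ ⟨q, hq⟩
    refine ⟨p + q, fun x y => ?_⟩
    simp only [ContinuousAlternatingMap.add_apply, add_apply, hp, hq]
    ring
  zero_mem' := ⟨0, fun x y => by simp⟩
  smul_mem' := by
    rintro r a ⟨p, hp⟩
    refine ⟨r • p, fun x y => ?_⟩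
    simp only [ContinuousAlternatingMap.smul_apply, smul_apply, hp, smul_eq_mul]
    ring

/-- The continuous Lie algebra cohomology `H²_c(L, ℝ)`, cocycles modulo coboundaries (as an
additive group). -/
abbrev H2c : Type u :=
  (cocycles₂ L).toAddSubgroup ⧸
    (coboundaries₂ L).toAddSubgroup.addSubgroupOf (cocycles₂ L).toAddSubgroup

/-- `[L, L]`, the linear span of the brackets. -/
def derivedAlg : Submodule ℝ L :=
  Submodule.span ℝ {x | ∃ y z : L, x = ⁅y, z⁆}

/-- `[L, [L, L]]`, the linear span of the brackets `[y, z]` with `z ∈ [L, L]`. -/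
def lowerCentral₂ : Submodule ℝ L :=
  Submodule.span ℝ {x | ∃ y : L, ∃ z ∈ derivedAlg L, x = ⁅y, z⁆}

end LieAlgebra

end LCLie

end

/-!
A bi-invariant form is determined by its value at `1`, so it suffices to show `η = ω_1 = 0`.

The form `η` is invariant: `η([X, Y], Z) + η(Y, [X, Z]) = 0` (`IsBiinvariant.invariant`). To see
this, `ω` is read in a chart at `1`. There both the derivatives of left translations and those of
right translations carry `η` to the value of `ω` at the translated point, and these two families of
derivatives differ to first order by the adjoint action (`IsLieGroup.exists_translation_derivs`):
the bracket of left-invariant vector fields is the antisymmetrized mixed second derivative of the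
local multiplication. Only the continuity of `ω` is used to pass to the limit.

An invariant alternating form satisfies `η([X, Y], Z) = 0`, because this expression is
antisymmetric in `X, Y` and symmetric in `Y, Z`. So `η` is a cocycle, hence `η(X, Y) = -p([X, Y])`
with `p` continuous and linear. Then `p` vanishes on `[𝔤, [𝔤, 𝔤]]`, by density on `[𝔤, 𝔤]`, and
`η = 0` (`eq_zero_of_invariant`).

The calculus needed for this (linearity of the derivative, the chain rule, the symmetry of second
derivatives) rests on a mean value theorem for maps into locally convex spaces, which is obtained
from the Hahn–Banach theorem, and on its consequence `IsC1At.tendsto_quotient`.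
-/

namespace LCLie

/-! ### First order Bastiani calculus -/

section FirstOrder

variable {E : Type*} [AddCommGroup E] [Module ℝ E]
  {F : Type*} [AddCommGroup F] [Module ℝ F] [TopologicalSpace F]
  {H : Type*} [AddCommGroup H] [Module ℝ H]

theorem HasDirDeriv.dirDeriv_eq [T2Space F] {f : E → F} {d : F} {x y : E}
    (h : HasDirDeriv f d x y) : dirDeriv f x y = d :=
  Tendsto.limUnder_eq h

theorem HasDirDeriv.unique [T2Space F] {f : E → F} {d d' : F} {x y : E}
    (h : HasDirDeriv f d x y) (h' : HasDirDeriv f d' x y) : d = d' :=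
  tendsto_nhds_unique h h'

theorem HasDirDeriv.hasDerivAt_line {f : E → F} {d : F} {p w : E} {s : ℝ}
    (h : HasDirDeriv f d (p + s • w) w) (φ : F →L[ℝ] ℝ) :
    HasDerivAt (fun r : ℝ => φ (f (p + r • w))) (φ d) s := by
  rw [hasDerivAt_iff_tendsto_slope_zero]
  refine ((φ.continuous.tendsto d).comp h).congr fun t => ?_
  simp [add_smul, add_assoc]

section MeanValue

variable [IsTopologicalAddGroup F] [ContinuousSMul ℝ F] [LocallyConvexSpace ℝ F]

/-- The mean value theorem: by the Hahn–Banach theorem, a difference quotient along a segment lies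
in every closed convex set that contains the derivatives along that segment. -/
theorem quotient_mem_of_hasDirDeriv_mem {f : E → F} {p w : E} {t : ℝ} (ht : t ≠ 0) {d : ℝ → F}
    {C : Set F} (hC : Convex ℝ C) (hC' : IsClosed C)
    (hd : ∀ s ∈ Icc (0 : ℝ) 1, HasDirDeriv f (d s) (p + (s * t) • w) w ∧ d s ∈ C) :
    t⁻¹ • (f (p + t • w) - f p) ∈ C := by
  by_contra hq
  obtain ⟨φ, u, hφ, hu⟩ := geometric_hahn_banach_point_closed hC hC' hq
  have hder : ∀ s ∈ Icc (0 : ℝ) 1,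
      HasDerivAt (fun s => φ (f (p + (s * t) • w))) (φ (d s) * t) s := fun s hs =>
    ((hd s hs).1.hasDerivAt_line φ).comp (h₂ := fun r => φ (f (p + r • w))) s
      (by simpa using (hasDerivAt_id s).mul_const t)
  obtain ⟨s, hs, hs'⟩ := exists_hasDerivAt_eq_slope (fun s => φ (f (p + (s * t) • w)))
    (fun s => φ (d s) * t) one_pos (fun s hs => (hder s hs).continuousAt.continuousWithinAt)
    fun s hs => hder s (Ioo_subset_Icc_self hs)
  have h1 := hu _ (hd s (Ioo_subset_Icc_self hs)).2
  have h2 : φ (t⁻¹ • (f (p + t • w) - f p)) = φ (d s) := by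
    simp only [one_mul, zero_mul, zero_smul, add_zero, sub_zero, div_one] at hs'
    rw [map_smul, map_sub, ← hs', smul_eq_mul]
    field_simp
  linarith

/-- Difference quotients converge as soon as the derivatives along the segments converge
uniformly. -/
theorem tendsto_quotient_of_hasDirDeriv {ι : Type*} {l : Filter ι} {f : ι → E → F} {t : ι → ℝ}
    {q w : ι → E} {d : ι → ℝ → F} {L : F} (ht : ∀ᶠ i in l, t i ≠ 0)
    (hd : ∀ᶠ x in l ×ˢ 𝓟 (Icc (0 : ℝ) 1),
      HasDirDeriv (f x.1) (d x.1 x.2) (q x.1 + (x.2 * t x.1) • w x.1) (w x.1))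
    (hL : Tendsto (fun x : ι × ℝ => d x.1 x.2) (l ×ˢ 𝓟 (Icc (0 : ℝ) 1)) (𝓝 L)) :
    Tendsto (fun i => (t i)⁻¹ • (f i (q i + t i • w i) - f i (q i))) l (𝓝 L) := by
  refine (closed_nhds_basis L).tendsto_right_iff.2 fun V ⟨hV, hVc⟩ => ?_
  obtain ⟨W, ⟨hW, hWconv⟩, hWV⟩ := (LocallyConvexSpace.convex_basis (𝕜 := ℝ) L).mem_iff.1 hV
  have hmem := hd.and (hL hW)
  rw [eventually_prod_principal_iff] at hmem
  filter_upwards [ht, hmem] with i hi hi'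
  exact hVc.closure_subset_iff.2 hWV <| quotient_mem_of_hasDirDeriv_mem hi hWconv.closure
    isClosed_closure fun s hs => ⟨(hi' s hs).1, subset_closure (hi' s hs).2⟩

end MeanValue

variable [TopologicalSpace E]

/-- `f` is `C^1` in the sense of Bastiani near `p`, with derivative `f'`: the directional derivative
`f' x y` exists for all `x` near `p` and all `y`, and `(x, y) ↦ f' x y` is continuous at each
`(p, y)`. -/
structure IsC1At (f : E → F) (f' : E → E → F) (p : E) : Prop where
  hasDirDeriv : ∀ᶠ x in 𝓝 p, ∀ y, HasDirDeriv f (f' x y) x y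
  continuousAt : ∀ y, ContinuousAt (fun q : E × E => f' q.1 q.2) (p, y)

theorem hasDirDeriv_id (x y : E) : HasDirDeriv (fun z => z) y x y := by
  refine tendsto_const_nhds.congr' ?_
  filter_upwards [self_mem_nhdsWithin] with t ht
  rw [add_sub_cancel_left, inv_smul_smul₀ ht]

theorem tendsto_line [IsTopologicalAddGroup E] [ContinuousSMul ℝ E] (x y : E) :
    Tendsto (fun t : ℝ => x + t • y) (𝓝[≠] 0) (𝓝 x) := by
  have : ContinuousAt (fun t : ℝ => x + t • y) 0 := by fun_prop
  simpa [ContinuousAt] using this.tendsto.mono_left nhdsWithin_le_nhds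

theorem HasDirDeriv.congr [IsTopologicalAddGroup E] [ContinuousSMul ℝ E] {f g : E → F} {d : F}
    {x y : E} (h : HasDirDeriv f d x y) (hfg : f =ᶠ[𝓝 x] g) : HasDirDeriv g d x y := by
  refine Tendsto.congr' ?_ h
  filter_upwards [tendsto_line x y hfg] with t ht
  have ht' : f (x + t • y) = g (x + t • y) := ht
  rw [ht', hfg.eq_of_nhds]

section ChainRule

variable [IsTopologicalAddGroup F] [ContinuousSMul ℝ F] [LocallyConvexSpace ℝ F]
  [IsTopologicalAddGroup E] [ContinuousSMul ℝ E]

theorem tendsto_segment {ι : Type*} {l : Filter ι} {t : ι → ℝ} {q w : ι → E} {p v : E}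
    (ht : Tendsto t l (𝓝 0)) (hq : Tendsto q l (𝓝 p)) (hw : Tendsto w l (𝓝 v)) :
    Tendsto (fun x : ι × ℝ => q x.1 + (x.2 * t x.1) • w x.1) (l ×ˢ 𝓟 (Icc (0 : ℝ) 1)) (𝓝 p) := by
  have hst : Tendsto (fun x : ι × ℝ => x.2 * t x.1) (l ×ˢ 𝓟 (Icc (0 : ℝ) 1)) (𝓝 0) := by
    refine squeeze_zero_norm' (a := fun x : ι × ℝ => |t x.1|) ?_ ?_
    · rw [eventually_prod_principal_iff]
      refine Eventually.of_forall fun i s hs => ?_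
      rw [Real.norm_eq_abs, abs_mul, abs_of_nonneg hs.1]
      exact mul_le_of_le_one_left (abs_nonneg _) hs.2
    · simpa using (ht.comp tendsto_fst).abs
  simpa using (hq.comp tendsto_fst).add (hst.smul (hw.comp tendsto_fst))

/-- For a `C^1` map, difference quotients with varying base point and direction converge to the
derivative. Linearity of the derivative, the chain rule and the symmetry of second derivatives all
come from this fact. -/
theorem IsC1At.tendsto_quotient {f : E → F} {f' : E → E → F} {p : E} (h : IsC1At f f' p)
    {ι : Type*} {l : Filter ι} {t : ι → ℝ} {q w : ι → E} {v : E}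
    (ht0 : ∀ᶠ i in l, t i ≠ 0) (ht : Tendsto t l (𝓝 0)) (hq : Tendsto q l (𝓝 p))
    (hw : Tendsto w l (𝓝 v)) :
    Tendsto (fun i => (t i)⁻¹ • (f (q i + t i • w i) - f (q i))) l (𝓝 (f' p v)) := by
  have hseg := tendsto_segment ht hq hw
  refine tendsto_quotient_of_hasDirDeriv (f := fun _ => f)
    (d := fun i s => f' (q i + (s * t i) • w i) (w i)) ht0 ?_ ?_
  · filter_upwards [hseg h.hasDirDeriv] with x hx
    exact hx _
  · exact (h.continuousAt v).tendsto.comp (hseg.prodMk_nhds (hw.comp tendsto_fst))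

theorem IsC1At.map_add [T2Space F] {f : E → F} {f' : E → E → F} {p : E} (h : IsC1At f f' p)
    (v w : E) : f' p (v + w) = f' p v + f' p w := by
  have ht0 : ∀ᶠ t : ℝ in 𝓝[≠] 0, t ≠ 0 := self_mem_nhdsWithin
  have ht : Tendsto (fun t : ℝ => t) (𝓝[≠] 0) (𝓝 0) := nhdsWithin_le_nhds
  refine (h.hasDirDeriv.self_of_nhds (v + w)).unique <|
    ((h.hasDirDeriv.self_of_nhds v).add
      (h.tendsto_quotient ht0 ht (tendsto_line p v) tendsto_const_nhds)).congr fun t => ?_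
  rw [← smul_add, smul_add t, add_assoc, add_comm, sub_add_sub_cancel]

theorem IsC1At.map_smul [T2Space F] {f : E → F} {f' : E → E → F} {p : E} (h : IsC1At f f' p)
    (c : ℝ) (v : E) : f' p (c • v) = c • f' p v := by
  rcases eq_or_ne c 0 with rfl | hc
  · have := h.map_add 0 0
    simpa using this
  have ht0 : ∀ᶠ t : ℝ in 𝓝[≠] 0, t * c ≠ 0 := by
    filter_upwards [self_mem_nhdsWithin] with t ht using mul_ne_zero ht hc
  have ht : Tendsto (fun t : ℝ => t * c) (𝓝[≠] 0) (𝓝 0) := by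
    have : Tendsto (fun t : ℝ => t) (𝓝[≠] 0) (𝓝 0) := nhdsWithin_le_nhds
    simpa using this.mul_const c
  refine (h.hasDirDeriv.self_of_nhds (c • v)).unique <|
    ((h.tendsto_quotient ht0 ht tendsto_const_nhds tendsto_const_nhds).const_smul c).congr
      fun t => ?_
  rw [smul_smul, smul_smul, mul_inv, mul_comm t⁻¹, mul_inv_cancel_left₀ hc]

/-- The chain rule. -/
theorem IsC1At.comp_hasDirDeriv {g : E → F} {g' : E → E → F} {f : H → E} {x y : H} {v : E}
    (hg : IsC1At g g' (f x)) (hf : HasDirDeriv f v x y) :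
    HasDirDeriv (fun z => g (f z)) (g' (f x) v) x y := by
  have ht0 : ∀ᶠ t : ℝ in 𝓝[≠] 0, t ≠ 0 := self_mem_nhdsWithin
  have ht : Tendsto (fun t : ℝ => t) (𝓝[≠] 0) (𝓝 0) := nhdsWithin_le_nhds
  refine (hg.tendsto_quotient ht0 ht tendsto_const_nhds hf).congr' ?_
  filter_upwards [ht0] with t h0
  rw [smul_inv_smul₀ h0, add_sub_cancel]

/-- Symmetry of second derivatives: both mixed derivatives are the limit of the second order
difference quotient `t⁻² (f (p + t u + t v) - f (p + t u) - f (p + t v) + f p)`. -/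
theorem second_dirDeriv_symm [T2Space F] {f : E → F} {f' fu fv : E → E → F} {p u v : E}
    (hf : ∀ᶠ x in 𝓝 p, ∀ y, HasDirDeriv f (f' x y) x y)
    (hu : IsC1At (fun x => f' x u) fu p) (hv : IsC1At (fun x => f' x v) fv p) :
    fu p v = fv p u := by
  have key : ∀ (u v : E) (fu : E → E → F), IsC1At (fun x => f' x u) fu p →
      Tendsto (fun t : ℝ => t⁻¹ • (t⁻¹ • (f (p + t • u + t • v) - f (p + t • u)) -
        t⁻¹ • (f (p + t • v) - f p))) (𝓝[≠] 0) (𝓝 (fu p v)) := by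
    intro u v fu hu
    have ht0 : ∀ᶠ t : ℝ in 𝓝[≠] 0, t ≠ 0 := self_mem_nhdsWithin
    have ht : Tendsto (fun t : ℝ => t) (𝓝[≠] 0) (𝓝 0) := nhdsWithin_le_nhds
    -- Mean value theorem in the direction `u` for `x ↦ t⁻¹ (f (x + t v) - f x)`.
    have hseg := tendsto_segment ht (tendsto_const_nhds (x := p)) (tendsto_const_nhds (x := u))
    have hseg' := tendsto_segment ht (tendsto_line p v) (tendsto_const_nhds (x := u))
    refine tendsto_quotient_of_hasDirDeriv (f := fun t x => t⁻¹ • (f (x + t • v) - f x))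
      (d := fun t s => t⁻¹ • (f' (p + (s * t) • u + t • v) u - f' (p + (s * t) • u) u))
      (q := fun _ => p) (w := fun _ => u) ht0 ?_ ?_
    · filter_upwards [hseg hf, hseg' hf] with x h1 h2
      have e : p + x.1 • v + (x.2 * x.1) • u = p + (x.2 * x.1) • u + x.1 • v := by abel
      have h2' := h2 u
      simp only [e] at h2'
      refine ((Tendsto.sub h2' (h1 u)).const_smul x.1⁻¹).congr fun r => ?_
      rw [← smul_sub, ← smul_sub, smul_comm, add_right_comm _ (x.1 • v), sub_sub_sub_comm]
    · exact hu.tendsto_quotient (tendsto_fst.eventually ht0) (ht.comp tendsto_fst) hseg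
        (tendsto_const_nhds (x := v))
  refine tendsto_nhds_unique (key u v fu hu) ((key v u fv hv).congr fun t => ?_)
  rw [← smul_sub, ← smul_sub, add_right_comm]
  congr 2
  abel

end ChainRule

section Smooth

theorem SmoothOn.continuousOn {f : E → F} {U : Set E} (hf : SmoothOn f U) : ContinuousOn f U := by
  obtain ⟨D, h0, -, hc⟩ := hf
  refine ((hc 0).comp (f := fun x => (x, fun i => i.elim0)) (by fun_prop)
    fun x hx => ⟨hx, mem_univ _⟩).congr fun x hx => (h0 x hx _).symm

/-- A Bastiani smooth map is `C^1`, and its derivative in a fixed direction is again `C^1`. -/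
theorem SmoothOn.exists_deriv [IsTopologicalAddGroup E] [ContinuousSMul ℝ E]
    {f : E → F} {U : Set E} (hf : SmoothOn f U) (hU : IsOpen U) :
    ∃ f' : E → E → F, (∀ x ∈ U, IsC1At f f' x) ∧
      ∀ u, ∃ f'' : E → E → F, ∀ x ∈ U, IsC1At (fun x => f' x u) f'' x := by
  obtain ⟨D, h0, hD, hc⟩ := hf
  have hC1 : ∀ (k : ℕ) (y : Fin k → E), ∀ x ∈ U, IsC1At (fun x => D k x y)
      (fun x z => D (k + 1) x (Fin.snoc y z : Fin (k + 1) → E)) x := by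
    refine fun k y x hx => ⟨?_, fun z => ?_⟩
    · filter_upwards [hU.mem_nhds hx] with x' hx' z using hD k x' hx' y z
    · have h1 := (hc (k + 1)).continuousAt (x := (x, (Fin.snoc y z : Fin (k + 1) → E)))
        (prod_mem_nhds (hU.mem_nhds hx) univ_mem)
      exact ContinuousAt.comp (x := (x, z))
        (f := fun q : E × E => (q.1, (Fin.snoc y q.2 : Fin (k + 1) → E))) h1
        (continuousAt_fst.prodMk (continuousAt_const.finSnoc continuousAt_snd))
  refine ⟨fun x z => D 1 x (Fin.snoc (fun i : Fin 0 => i.elim0) z : Fin 1 → E), fun x hx => ?_,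
    fun u => ⟨_, fun x hx => hC1 1 _ x hx⟩⟩
  have h := hC1 0 (fun i => i.elim0) x hx
  refine ⟨?_, h.continuousAt⟩
  filter_upwards [h.hasDirDeriv, hU.mem_nhds hx] with x' hx' hx'U z
  refine (hx' z).congr ?_
  filter_upwards [hU.mem_nhds hx'U] with x'' hx'' using h0 x'' hx'' _

end Smooth

end FirstOrder

/-! ### Tangent maps in charts -/

section Charts

variable {E : Type*} [AddCommGroup E] [Module ℝ E] [TopologicalSpace E]
  [IsTopologicalAddGroup E] [ContinuousSMul ℝ E]
  {M : Type*} [TopologicalSpace M] [ChartedSpace E M]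

theorem IsSmoothAtlas.exists_isC1At (hM : IsSmoothAtlas E M) {e e' : OpenPartialHomeomorph M E}
    (he : e ∈ atlas E M) (he' : e' ∈ atlas E M) {x : E} (hx : x ∈ e.target)
    (hx' : e.symm x ∈ e'.source) :
    ∃ κ' : E → E → E, IsC1At (fun z => e' (e.symm z)) κ' x := by
  obtain ⟨κ', h, -⟩ := (hM e he e' he').exists_deriv (e.isOpen_inter_preimage_symm e'.open_source)
  exact ⟨κ', h x ⟨hx, hx'⟩⟩

variable [T2Space E]

theorem IsSmoothAtlas.exists_isC1At_tangentMap_symm (hM : IsSmoothAtlas E M)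
    {e : OpenPartialHomeomorph M E} (he : e ∈ atlas E M) {x : E} (hx : x ∈ e.target) :
    ∃ κ' : E → E → E, IsC1At (fun z => chartAt E (e.symm x) (e.symm z)) κ' x ∧
      ∀ v : E, tangentMap E E (e.symm : E → M) x v = κ' x v := by
  obtain ⟨κ', h⟩ := hM.exists_isC1At he (chart_mem_atlas E (e.symm x)) hx (mem_chart_source E _)
  exact ⟨κ', h, fun v => (h.hasDirDeriv.self_of_nhds v).dirDeriv_eq⟩

variable [LocallyConvexSpace ℝ E]

theorem IsSmoothAtlas.tangentMap_symm_add (hM : IsSmoothAtlas E M)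
    {e : OpenPartialHomeomorph M E} (he : e ∈ atlas E M) {x : E} (hx : x ∈ e.target) (v w : E) :
    tangentMap E E (e.symm : E → M) x (v + w : E) =
      tangentMap E E (e.symm : E → M) x v + tangentMap E E (e.symm : E → M) x w := by
  obtain ⟨κ', h, h'⟩ := hM.exists_isC1At_tangentMap_symm he hx
  rw [h', h', h']
  exact h.map_add v w

theorem IsSmoothAtlas.tangentMap_symm_smul (hM : IsSmoothAtlas E M)
    {e : OpenPartialHomeomorph M E} (he : e ∈ atlas E M) {x : E} (hx : x ∈ e.target) (c : ℝ)
    (v : E) :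
    tangentMap E E (e.symm : E → M) x (c • v : E) = c • tangentMap E E (e.symm : E → M) x v := by
  obtain ⟨κ', h, h'⟩ := hM.exists_isC1At_tangentMap_symm he hx
  rw [h', h']
  exact h.map_smul c v

/-- If `φ` has derivative `v` in the chart `e`, then its derivative in the preferred chart at the
point `e⁻¹ x` is `T_x e⁻¹ (v)`. -/
theorem IsSmoothAtlas.hasDirDeriv_chartAt (hM : IsSmoothAtlas E M)
    {e : OpenPartialHomeomorph M E} (he : e ∈ atlas E M) {x : E} (hx : x ∈ e.target)
    {φ : E → M} {a y v : E} (hφ : ContinuousAt φ a) (hφx : φ a = e.symm x)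
    (h : HasDirDeriv (fun z => e (φ z)) v a y) :
    HasDirDeriv (fun z => chartAt E (e.symm x) (φ z)) (tangentMap E E (e.symm : E → M) x v : E)
      a y := by
  obtain ⟨κ', hκ, hκ'⟩ := hM.exists_isC1At_tangentMap_symm he hx
  have hex : e (φ a) = x := by rw [hφx, e.right_inv hx]
  rw [hκ']
  have hκ2 : IsC1At (fun z => chartAt E (e.symm x) (e.symm z)) κ' (e (φ a)) := by rwa [hex]
  have h2 := hκ2.comp_hasDirDeriv (f := fun z => e (φ z)) h
  rw [hex] at h2
  refine h2.congr ?_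
  have hs : φ a ∈ e.source := hφx ▸ e.map_target hx
  filter_upwards [hφ (e.open_source.mem_nhds hs)] with z hz
  rw [e.left_inv hz]

/-- `T e` is inverse to `T e⁻¹`: the expression in the chart `e` of a vector field which is
`T_x e⁻¹ (v)` at `e⁻¹ x` takes the value `v` at `x`. -/
theorem IsSmoothAtlas.localRep_eq (hM : IsSmoothAtlas E M)
    {e : OpenPartialHomeomorph M E} (he : e ∈ atlas E M) {x : E} (hx : x ∈ e.target)
    {X : (p : M) → TangentAt E p} {v : E}
    (hX : X (e.symm x) = tangentMap E E (e.symm : E → M) x v) : localRep E X e x = v := by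
  set p := e.symm x with hp
  have hps : p ∈ e.source := e.map_target hx
  obtain ⟨κ', hκ, hκ'⟩ := hM.exists_isC1At_tangentMap_symm he hx
  obtain ⟨μ, hμ⟩ := hM.exists_isC1At (chart_mem_atlas E p) he
    (mem_chart_target E p) (by rwa [(chartAt E p).left_inv (mem_chart_source E p)])
  have hcomp := hμ.comp_hasDirDeriv
    (f := fun z => chartAt E p (e.symm z)) (hκ.hasDirDeriv.self_of_nhds v)
  have hid : HasDirDeriv (fun z : E => z) (μ (chartAt E p p) (κ' x v)) x v := by
    refine hcomp.congr ?_
    have h1 : ∀ᶠ z in 𝓝 x, e.symm z ∈ (chartAt E p).source :=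
      (e.continuousAt_symm hx) ((chartAt E p).open_source.mem_nhds (mem_chart_source E p))
    filter_upwards [h1, e.open_target.mem_nhds hx] with z hz hz'
    rw [(chartAt E p).left_inv hz, e.right_inv hz']
  have h2 : localRep E X e x = μ (chartAt E p p) (X p) :=
    (hμ.hasDirDeriv.self_of_nhds (X p)).dirDeriv_eq
  rw [h2, hX, hκ']
  exact hid.unique (hasDirDeriv_id x v)

end Charts

/-! ### Left and right translations near the identity -/

section Translations

variable {E : Type*} [AddCommGroup E] [Module ℝ E] [TopologicalSpace E]
  [IsTopologicalAddGroup E] [ContinuousSMul ℝ E] [LocallyConvexSpace ℝ E] [T2Space E]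
  {G : Type*} [Group G] [TopologicalSpace G] [ChartedSpace E G]

/-- In the preferred chart `e` at `1`, let `A_x` and `C_x` be the tangent maps at `1` of left and
right translation by `e⁻¹ x`, read in `e`. They are the partial derivatives of the multiplication
`(x, y) ↦ e (e⁻¹ x * e⁻¹ y)` at `(x, e 1)` and `(e 1, x)`, and the derivative of `A_x Y - C_x Y` at
`x = e 1` in the direction `X` is `[X, Y]`. -/
theorem IsLieGroup.exists_translation_derivs (hG : IsLieGroup E G) :
    ∃ A C : E → E → E,
      (∀ x ∈ (chartAt E (1 : G)).target, ∀ y : E,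
        HasDirDeriv (fun z => chartAt E ((chartAt E (1 : G)).symm x)
          ((chartAt E (1 : G)).symm x * (chartAt E (1 : G)).symm z))
          (tangentMap E E ((chartAt E (1 : G)).symm : E → G) x (A x y) : E)
          (chartAt E (1 : G) 1) y) ∧
      (∀ x ∈ (chartAt E (1 : G)).target, ∀ y : E,
        HasDirDeriv (fun z => chartAt E ((chartAt E (1 : G)).symm x)
          ((chartAt E (1 : G)).symm z * (chartAt E (1 : G)).symm x))
          (tangentMap E E ((chartAt E (1 : G)).symm : E → G) x (C x y) : E)
          (chartAt E (1 : G) 1) y) ∧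
      (∀ y, Tendsto (fun x => A x y) (𝓝 (chartAt E (1 : G) 1)) (𝓝 y)) ∧
      (∀ y, Tendsto (fun x => C x y) (𝓝 (chartAt E (1 : G) 1)) (𝓝 y)) ∧
      ∀ X Y : LieAlg E G, HasDirDeriv (fun x => A x Y - C x Y) (⁅X, Y⁆ : LieAlg E G)
        (chartAt E (1 : G) 1) X := by
  set e := chartAt E (1 : G) with he_def
  set a := e 1 with ha_def
  have he : e ∈ atlas E G := chart_mem_atlas E 1
  have h1 : (1 : G) ∈ e.source := mem_chart_source E 1
  have ha : a ∈ e.target := mem_chart_target E 1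
  have hsa : e.symm a = 1 := e.left_inv h1
  have hcm : ContinuousMul G := ⟨hG.continuous_mul⟩
  set U : Set (E × E) :=
    {p | p.1 ∈ e.target ∧ p.2 ∈ e.target ∧ e.symm p.1 * e.symm p.2 ∈ e.source} with hU_def
  have hU : IsOpen U := by
    have hc : ContinuousOn (fun p : E × E => e.symm p.1 * e.symm p.2) (e.target ×ˢ e.target) :=
      (e.continuousOn_symm.comp continuousOn_fst fun p hp => hp.1).mul
        (e.continuousOn_symm.comp continuousOn_snd fun p hp => hp.2)
    convert hc.isOpen_inter_preimage (e.open_target.prod e.open_target) e.open_source using 1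
    ext p
    simp [hU_def, and_assoc]
  obtain ⟨m', hm, hm2⟩ := (hG.smooth_mul e he e he e he).exists_deriv hU
  have hUl : ∀ x ∈ e.target, (x, a) ∈ U := fun x hx => ⟨hx, ha, by
    simpa [hsa] using e.map_target hx⟩
  have hUr : ∀ x ∈ e.target, (a, x) ∈ U := fun x hx => ⟨ha, hx, by
    simpa [hsa] using e.map_target hx⟩
  have hA : ∀ x ∈ e.target, ∀ y : E,
      HasDirDeriv (fun z => e (e.symm x * e.symm z)) (m' (x, a) (0, y)) a y := fun x hx y =>
    Tendsto.congr (fun t => by simp) ((hm _ (hUl x hx)).hasDirDeriv.self_of_nhds (0, y))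
  have hC : ∀ x ∈ e.target, ∀ y : E,
      HasDirDeriv (fun z => e (e.symm z * e.symm x)) (m' (a, x) (y, 0)) a y := fun x hx y =>
    Tendsto.congr (fun t => by simp) ((hm _ (hUr x hx)).hasDirDeriv.self_of_nhds (y, 0))
  have hAT := fun x hx y => hG.smooth_atlas.hasDirDeriv_chartAt he hx
    (φ := fun z => e.symm x * e.symm z)
    (continuousAt_const.mul (e.continuousAt_symm ha)) (by rw [hsa, mul_one]) (hA x hx y)
  have hCT := fun x hx y => hG.smooth_atlas.hasDirDeriv_chartAt he hx
    (φ := fun z => e.symm z * e.symm x)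
    ((e.continuousAt_symm ha).mul continuousAt_const) (by rw [hsa, one_mul]) (hC x hx y)
  have hAa : ∀ y, m' (a, a) (0, y) = y := fun y =>
    (hA a ha y).unique <| (hasDirDeriv_id a y).congr <| by
      filter_upwards [e.open_target.mem_nhds ha] with z hz
      rw [hsa, one_mul, e.right_inv hz]
  have hCa : ∀ y, m' (a, a) (y, 0) = y := fun y =>
    (hC a ha y).unique <| (hasDirDeriv_id a y).congr <| by
      filter_upwards [e.open_target.mem_nhds ha] with z hz
      rw [hsa, mul_one, e.right_inv hz]
  choose m'' hm'' using hm2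
  have hdA : ∀ X Y : E,
      HasDirDeriv (fun x => m' (x, a) (0, Y)) (m'' (0, Y) (a, a) (X, 0)) a X := fun X Y =>
    Tendsto.congr (fun t => by simp) ((hm'' (0, Y) _ (hUl a ha)).hasDirDeriv.self_of_nhds (X, 0))
  have hdC : ∀ X Y : E,
      HasDirDeriv (fun x => m' (a, x) (Y, 0)) (m'' (Y, 0) (a, a) (0, X)) a X := fun X Y =>
    Tendsto.congr (fun t => by simp) ((hm'' (Y, 0) _ (hUl a ha)).hasDirDeriv.self_of_nhds (0, X))
  have hsymm : ∀ X Y : E, m'' (Y, 0) (a, a) (0, X) = m'' (0, X) (a, a) (Y, 0) := fun X Y =>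
    second_dirDeriv_symm (hm _ (hUl a ha) |>.hasDirDeriv) (hm'' _ _ (hUl a ha))
      (hm'' _ _ (hUl a ha))
  -- In the chart `e`, the left-invariant vector field of `Y` is `x ↦ A_x Y`.
  have hleft : ∀ (Y : E), ∀ x ∈ e.target,
      localRep E (leftInvariant E (G := G) Y) e x = m' (x, a) (0, Y) := by
    intro Y x hx
    refine hG.smooth_atlas.localRep_eq he hx ?_
    have h := (hAT x hx Y).dirDeriv_eq
    rw [← h]
    change dirDeriv (fun z => chartAt E (e.symm x * 1) (e.symm x * e.symm z)) a Y = _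
    rw [mul_one]
  have hbr : ∀ X Y : E,
      (vfBracket E (leftInvariant E (G := G) X) (leftInvariant E (G := G) Y) 1 : E) =
        m'' (0, Y) (a, a) (X, 0) - m'' (0, X) (a, a) (Y, 0) := by
    intro X Y
    have hev : ∀ Z : E,
        (fun x => m' (x, a) (0, Z)) =ᶠ[𝓝 a]
          localRep E (leftInvariant E (G := G) Z) e := fun Z => by
      filter_upwards [e.open_target.mem_nhds ha] with x hx using (hleft Z x hx).symm
    change dirDeriv (localRep E (leftInvariant E (G := G) Y) e) a
        (localRep E (leftInvariant E (G := G) X) e a) -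
      dirDeriv (localRep E (leftInvariant E (G := G) X) e) a
        (localRep E (leftInvariant E (G := G) Y) e a) = _
    rw [hleft X a ha, hleft Y a ha, hAa, hAa, ((hdA X Y).congr (hev Y)).dirDeriv_eq,
      ((hdA Y X).congr (hev X)).dirDeriv_eq]
  refine ⟨fun x y => m' (x, a) (0, y), fun x y => m' (a, x) (y, 0), hAT, hCT, fun y => ?_,
    fun y => ?_, fun X Y => ?_⟩
  · have h := (hm _ (hUl a ha)).continuousAt (0, y)
    have := h.comp (x := a) (f := fun x : E => ((x, a), ((0 : E), y))) (by fun_prop)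
    simpa [ContinuousAt, hAa, Function.comp_def] using this
  · have h := (hm _ (hUl a ha)).continuousAt (y, 0)
    have := h.comp (x := a) (f := fun x : E => ((a, x), (y, (0 : E)))) (by fun_prop)
    simpa [ContinuousAt, hCa, Function.comp_def] using this
  · change E at X Y
    change HasDirDeriv (fun x => m' (x, a) (0, Y) - m' (a, x) (Y, 0))
      (vfBracket E (leftInvariant E (G := G) X) (leftInvariant E (G := G) Y) 1 : E) a X
    rw [hbr X Y, ← hsymm X Y]
    refine (Tendsto.sub (hdA X Y) (hdC X Y)).congr fun t => ?_
    rw [← smul_sub, sub_sub_sub_comm]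

end Translations

/-! ### Alternating bilinear forms -/

section Alternating

variable {L : Type*} [AddCommGroup L] [Module ℝ L] [TopologicalSpace L]

theorem alternating_swap (η : L [⋀^Fin 2]→L[ℝ] ℝ) (x y : L) : η ![x, y] = -η ![y, x] := by
  have h : ![x, y] = ![y, x] ∘ Equiv.swap 0 1 := by
    ext i
    fin_cases i <;> rfl
  rw [h]
  exact η.toAlternatingMap.map_swap ![y, x] (by decide)

theorem alternating_sub_left (η : L [⋀^Fin 2]→L[ℝ] ℝ) (x x' y : L) :
    η ![x - x', y] = η ![x, y] - η ![x', y] :=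
  η.map_vecCons_sub x x' ![y]

theorem alternating_smul_left (η : L [⋀^Fin 2]→L[ℝ] ℝ) (c : ℝ) (x y : L) :
    η ![c • x, y] = c * η ![x, y] :=
  η.vecCons_smul ![y] c x

theorem alternating_quotient (η : L [⋀^Fin 2]→L[ℝ] ℝ) (c : ℝ) (x x' y y' : L) :
    c * (η ![x, y] - η ![x', y']) = η ![c • (x - x'), y] + η ![x', c • (y - y')] := by
  rw [alternating_smul_left, alternating_swap η x' (c • _), alternating_smul_left,
    alternating_sub_left, alternating_sub_left, alternating_swap η y, alternating_swap η y']
  ring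

variable [Bracket L L]

/-- If an alternating form `η` is invariant, then `η([x, y], z)` is antisymmetric in `x, y` and
symmetric in `y, z`, which forces it to vanish. -/
theorem alternating_bracket_eq_zero (hskew : ∀ x y : L, ⁅x, y⁆ = -⁅y, x⁆)
    (η : L [⋀^Fin 2]→L[ℝ] ℝ) (hη : ∀ x y z : L, η ![⁅x, y⁆, z] + η ![y, ⁅x, z⁆] = 0)
    (x y z : L) : η ![⁅x, y⁆, z] = 0 := by
  have hsymm : ∀ x y z : L, η ![⁅x, y⁆, z] = η ![⁅x, z⁆, y] := fun x y z => by
    rw [eq_neg_of_add_eq_zero_left (hη x y z), alternating_swap, neg_neg]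
  have hanti : ∀ x y z : L, η ![⁅x, y⁆, z] = -η ![⁅y, x⁆, z] := fun x y z => by
    rw [hskew x y, ← neg_one_smul ℝ, alternating_smul_left, neg_one_mul]
  linarith [hsymm x y z, hanti x z y, hsymm z x y, hanti z y x, hsymm y z x, hanti y x z]

/-- The purely algebraic part of the argument: under the two hypotheses on the Lie algebra, an
invariant alternating form vanishes. It is a cocycle, hence `η(x, y) = -p [x, y]`, and `p` vanishes
on `[L, [L, L]]`, hence by density on `[L, L]`. -/
theorem eq_zero_of_invariant (hskew : ∀ x y : L, ⁅x, y⁆ = -⁅y, x⁆) (hcoh : Subsingleton (H2c L))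
    (hdense : Dense {x : derivedAlg L | (x : L) ∈ lowerCentral₂ L})
    (η : L [⋀^Fin 2]→L[ℝ] ℝ) (hη : ∀ x y z : L, η ![⁅x, y⁆, z] + η ![y, ⁅x, z⁆] = 0) : η = 0 := by
  have h0 := alternating_bracket_eq_zero hskew η hη
  have hcocycle : η ∈ cocycles₂ L := fun x y z => by rw [h0, h0, h0]; ring
  obtain ⟨p, hp⟩ : η ∈ coboundaries₂ L :=
    AddSubgroup.addSubgroupOf_eq_top.1 (QuotientAddGroup.subsingleton_iff.1 hcoh) hcocycle
  have hη' : ∀ y : L, ∀ z ∈ derivedAlg L, η ![z, y] = 0 := by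
    intro y z hz
    induction hz using Submodule.span_induction with
    | mem z hz =>
      obtain ⟨a, b, rfl⟩ := hz
      exact h0 a b y
    | zero => exact η.map_coord_zero 0 rfl
    | add z w _ _ hz hw => exact (η.vecCons_add ![y] z w).trans (by rw [hz, hw, add_zero])
    | smul c z _ hz => rw [alternating_smul_left, hz, mul_zero]
  have hp2 : ∀ x ∈ lowerCentral₂ L, p x = 0 := by
    intro x hx
    refine Submodule.span_le (p := LinearMap.ker p.toLinearMap).2 ?_ hx
    rintro _ ⟨y, z, hz, rfl⟩
    have h := hp y z
    rw [alternating_swap, hη' y z hz] at h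
    simpa using h
  have hp1 : ∀ x : derivedAlg L, p x = 0 := fun x =>
    congrFun (Continuous.ext_on hdense (p.continuous.comp continuous_subtype_val)
      continuous_const fun z hz => hp2 z hz) x
  ext v
  have hv : v = ![v 0, v 1] := by
    ext i
    fin_cases i <;> rfl
  have h := hp1 ⟨_, Submodule.subset_span ⟨v 0, v 1, rfl⟩⟩
  rw [hv, hp, h]
  simp

end Alternating

/-! ### Bi-invariant forms -/

section Biinvariant

variable {E : Type*} [AddCommGroup E] [Module ℝ E] [TopologicalSpace E]

section

variable {M : Type*} [TopologicalSpace M] [ChartedSpace E M]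

/-- Equal points of `M` have the same preferred chart, so that a form takes the same values on
tangent vectors with the same components. -/
theorem FormField.apply_congr {k : ℕ} (ω : FormField E M k) {p q : M} (h : p = q) (φ : E → M)
    (a : E) (y : Fin k → E) :
    ω p (fun i => (dirDeriv (fun z => chartAt E p (φ z)) a (y i) : E)) =
      ω q (fun i => (dirDeriv (fun z => chartAt E q (φ z)) a (y i) : E)) := by
  subst h
  rfl

theorem isDifferentialForm_zero [IsTopologicalAddGroup E] [ContinuousSMul ℝ E] (k : ℕ) :
    IsDifferentialForm E (0 : FormField E M k) := by
  refine fun e he => ⟨fun _ _ _ => 0, fun _ _ _ => rfl, fun _ _ _ _ _ => ?_, fun _ =>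
    continuousOn_const⟩
  simp [HasDirDeriv]

end

variable {G : Type*} [Group G] [TopologicalSpace G] [ChartedSpace E G]

theorem IsBiinvariant.eq_zero {k : ℕ} {ω : FormField E G k} (hω : IsBiinvariant E ω)
    (h1 : ω 1 = 0) : ω = 0 := by
  funext g
  ext y
  have h0 : ω (g⁻¹ * g) = 0 := by rw [inv_mul_cancel, h1]
  rw [← (hω g⁻¹ g y).1, h0]
  rfl

theorem lieAlg_bracket_skew (X Y : LieAlg E G) : ⁅X, Y⁆ = -⁅Y, X⁆ :=
  (neg_sub _ _).symm

variable [IsTopologicalAddGroup E] [ContinuousSMul ℝ E] [LocallyConvexSpace ℝ E] [T2Space E]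

/-- The value at `1` of a bi-invariant form is invariant under the adjoint representation. In the
preferred chart `e` at `1` let `Ω_x` be the pullback of the form under `e⁻¹`, and `A_x`, `C_x` the
derivatives of left and right translation by `e⁻¹ x`. Then
`Ω_x(A_x Y, A_x Z) = ω_1(Y, Z) = Ω_x(C_x Y, C_x Z)`, and division of the difference by `t`, where
`x = e 1 + t X`, gives the claim in the limit `t → 0`. -/
theorem IsBiinvariant.invariant (hG : IsLieGroup E G) {ω : FormField E G 2}
    (hω : IsDifferentialForm E ω) (hinv : IsBiinvariant E ω) (X Y Z : LieAlg E G) :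
    ω 1 ![⁅X, Y⁆, Z] + ω 1 ![Y, ⁅X, Z⁆] = 0 := by
  obtain ⟨A, C, hA, hC, hA1, hC1, hbr⟩ := hG.exists_translation_derivs
  set e := chartAt E (1 : G) with he_def
  set a := e 1 with ha_def
  have he : e ∈ atlas E G := chart_mem_atlas E 1
  have ha : a ∈ e.target := mem_chart_target E 1
  set Ω : E → (Fin 2 → E) → ℝ := fun x y =>
    ω (e.symm x) (fun i => tangentMap E E (e.symm : E → G) x (y i)) with hΩ
  have hΩA : ∀ x ∈ e.target, ∀ y : Fin 2 → E, Ω x (fun i => A x (y i)) = ω 1 y := by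
    intro x hx y
    have h1 : Ω x (fun i => A x (y i)) = ω (e.symm x) (fun i =>
        (dirDeriv (fun z => chartAt E (e.symm x) (e.symm x * e.symm z)) a (y i) : E)) :=
      congrArg (ω (e.symm x)) (funext fun i => ((hA x hx (y i)).dirDeriv_eq).symm)
    rw [h1, ← FormField.apply_congr ω (mul_one (e.symm x))]
    exact (hinv (e.symm x) 1 y).1
  have hΩC : ∀ x ∈ e.target, ∀ y : Fin 2 → E, Ω x (fun i => C x (y i)) = ω 1 y := by
    intro x hx y
    have h1 : Ω x (fun i => C x (y i)) = ω (e.symm x) (fun i =>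
        (dirDeriv (fun z => chartAt E (e.symm x) (e.symm z * e.symm x)) a (y i) : E)) :=
      congrArg (ω (e.symm x)) (funext fun i => ((hC x hx (y i)).dirDeriv_eq).symm)
    rw [h1, ← FormField.apply_congr ω (one_mul (e.symm x))]
    exact (hinv (e.symm x) 1 y).2
  have hAa : ∀ y, A a y = y := fun y => eq_of_tendsto_nhds (f := fun x => A x y) (hA1 y)
  have hCa : ∀ y, C a y = y := fun y => eq_of_tendsto_nhds (f := fun x => C x y) (hC1 y)
  have hΩa : ∀ y : Fin 2 → E, Ω a y = ω 1 y := fun y => by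
    have h := hΩA a ha y
    simpa only [hAa] using h
  have hvec : ∀ (f : E → E) (u w : E), (fun i => f (![u, w] i)) = ![f u, f w] := fun f u w => by
    ext i
    fin_cases i <;> rfl
  have hcont : ∀ y, Tendsto (fun q : E × (Fin 2 → E) => Ω q.1 q.2) (𝓝 (a, y)) (𝓝 (ω 1 y)) := by
    intro y
    have h := (hω e he).continuousOn.continuousAt (x := (a, y))
      (prod_mem_nhds (e.open_target.mem_nhds ha) univ_mem)
    rw [← hΩa y]
    exact h
  have hquot : ∀ x ∈ e.target, ∀ (c : ℝ) (u u' w w' : E),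
      c * (Ω x ![u, w] - Ω x ![u', w']) = Ω x ![c • (u - u'), w] + Ω x ![u', c • (w - w')] := by
    intro x hx c u u' w w'
    have hT : ∀ u w : E, Ω x ![u, w] = ω (e.symm x) ![tangentMap E E (e.symm : E → G) x u,
        tangentMap E E (e.symm : E → G) x w] := fun u w =>
      congrArg (ω (e.symm x)) (hvec (tangentMap E E (e.symm : E → G) x) u w)
    have hlin : ∀ u u' : E, tangentMap E E (e.symm : E → G) x (c • (u - u') : E) =
        c • (tangentMap E E (e.symm : E → G) x u - tangentMap E E (e.symm : E → G) x u') := by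
      intro u u'
      have h := hG.smooth_atlas.tangentMap_symm_add he hx (u - u') u'
      rw [sub_add_cancel] at h
      rw [hG.smooth_atlas.tangentMap_symm_smul he hx, h, add_sub_cancel_right]
    simp only [hT, hlin]
    exact alternating_quotient _ _ _ _ _ _
  change E at X Y Z
  have hline := tendsto_line a X
  have hAline : ∀ Y, Tendsto (fun t : ℝ => A (a + t • X) Y) (𝓝[≠] 0) (𝓝 Y) :=
    fun Y => (hA1 Y).comp hline
  have hCline : ∀ Y, Tendsto (fun t : ℝ => C (a + t • X) Y) (𝓝[≠] 0) (𝓝 Y) :=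
    fun Y => (hC1 Y).comp hline
  have hbr' : ∀ Y : E, Tendsto (fun t : ℝ => t⁻¹ • (A (a + t • X) Y - C (a + t • X) Y))
      (𝓝[≠] 0) (𝓝 (vfBracket E (leftInvariant E (G := G) X) (leftInvariant E (G := G) Y) 1)) := by
    intro Y
    refine Tendsto.congr (fun t => ?_) (hbr X Y)
    change t⁻¹ • (A (a + t • X) Y - C (a + t • X) Y - (A a Y - C a Y)) = _
    rw [hAa, hCa, sub_self, sub_zero]
  have hpair : ∀ {f g : ℝ → E} {u w : E}, Tendsto f (𝓝[≠] 0) (𝓝 u) → Tendsto g (𝓝[≠] 0) (𝓝 w) →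
      Tendsto (fun t => Ω (a + t • X) ![f t, g t]) (𝓝[≠] 0) (𝓝 (ω 1 ![u, w])) := by
    intro f g u w hf hg
    refine (hcont ![u, w]).comp (hline.prodMk_nhds (tendsto_pi_nhds.2 fun i => ?_))
    fin_cases i
    exacts [hf, hg]
  refine tendsto_nhds_unique ((hpair (hbr' Y) (hAline Z)).add (hpair (hCline Y) (hbr' Z)))
    (tendsto_const_nhds.congr' ?_)
  filter_upwards [hline (e.open_target.mem_nhds ha)] with t ht
  have h1 := hΩA _ ht ![Y, Z]
  have h2 := hΩC _ ht ![Y, Z]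
  rw [hvec] at h1 h2
  rw [← hquot _ ht, h1, h2, sub_self, mul_zero]

end Biinvariant

end LCLie

theorem mainTheorem5 {E : Type*} [AddCommGroup E] [Module ℝ E] [TopologicalSpace E]
    [IsTopologicalAddGroup E] [ContinuousSMul ℝ E] [LocallyConvexSpace ℝ E] [T2Space E]
    {G : Type*} [Group G] [TopologicalSpace G] [T2Space G] [ChartedSpace E G]
    (hG : LCLie.IsLieGroup E G) (hreg : LCLie.IsMilnorRegular E G)
    (hcoh : Subsingleton (LCLie.H2c (LCLie.LieAlg E G)))
    (hdense : Dense {x : LCLie.derivedAlg (LCLie.LieAlg E G) |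
      (x : LCLie.LieAlg E G) ∈ LCLie.lowerCentral₂ (LCLie.LieAlg E G)}) :
    LCLie.biinvariantForms E G 2 = {0} := by
  refine Set.eq_singleton_iff_unique_mem.2
    ⟨⟨LCLie.isDifferentialForm_zero 2, fun _ _ _ => ⟨rfl, rfl⟩⟩, fun ω hω => ?_⟩
  exact hω.2.eq_zero <| LCLie.eq_zero_of_invariant LCLie.lieAlg_bracket_skew hcoh hdense _
    (hω.2.invariant hG hω.1)
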